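/- Consider a market with $m_S$ sellers, each holding one of $m_S$ identical indivisible items, and $m_B$ buyers, each wanting one item. The sellers' values $s_i\ge 0$ are drawn from a distribution $F_S$ and the buyers' values $b_j\ge 0$ from a distribution $F_B$, all independently. An allocation is a choice of $m_S$ agents who hold an item; its welfare is the sum of their values, and its gains from trade are its welfare minus $\sum_i s_i$. Let $\mathrm{OPT}(m_S,m_B)$ be the expected maximum, over all allocations, of the gains from trade. The Buyer Trade Reduction (BTR) mechanism works as follows. Let $q$ be the largest number of trading buyers (buyers who hold an item) in a welfare-maximizing allocation, let $b^{(j)}$ be the $j$-th highest buyer value and $s^{(j)}$ the $j$-th lowest seller value. If $q\ge 1$, there are at least $q+1$ buyers and $b^{(q+1)}\ge s^{(q)}$, then the $q$ lowest-value sellers trade with the $q$ highest-value buyers (at price $b^{(q+1)}$). Otherwise the $\max(q-1,0)$ lowest-value sellers trade with the $\max(q-1,0)$ highest-value buyers (each of these sellers receiving $s^{(q)}$ and each of these buyers paying $b^{(q)}$). Let $\mathrm{BTR}(m_S,n)$ be the expected gains from trade of this mechanism with $m_S$ sellers and $n$ buyers. (Both expectations are of nonnegative quantities and may be infinite.) For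 a distribution $F$ and $p\in[0,1]$ let $v_F(p)=\inf\{v\in\mathbb{R} : \Pr_{w\sim F}[w\le v]\ge p\}\in[-\infty,\infty]$. Suppose that $F_B$ first-order stochastically dominates $F_S$, that is, $v_{F_B}(p)\ge v_{F_S}(p)$ for every $p\in[0,1]$. Theorem. For all $m_S,m_B\ge 0$ and every integer $n\ge m_S\,(m_B+4\sqrt{m_B})$, $$\mathrm{BTR}(m_S,n)\;\ge\;\mathrm{OPT}(m_S,m_B).$$ -/

import Mathlib

open MeasureTheory

noncomputable section

namespace DoubleAuction

/-! A market has `mS` sellers, each holding one item, and `mB` buyers, each wanting one item.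
Its agents are the elements of `Fin mS ⊕ Fin mB`, the seller values are `s : Fin mS → ℝ`
and the buyer values are `b : Fin mB → ℝ`. -/

/-- All allocations: an allocation is a set of `mS` agents, those who hold an item. -/
def allocations (mS mB : ℕ) : Finset (Finset (Fin mS ⊕ Fin mB)) :=
  Finset.powersetCard mS Finset.univ

theorem allocations_nonempty (mS mB : ℕ) : (allocations mS mB).Nonempty := by
  unfold allocations
  rw [Finset.powersetCard_nonempty]
  simp

/-- Social welfare of an allocation: the sum of the values of the agents who hold an item. -/
def welfare {mS mB : ℕ} (s : Fin mS → ℝ) (b : Fin mB → ℝ)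
    (A : Finset (Fin mS ⊕ Fin mB)) : ℝ :=
  ∑ a ∈ A, Sum.elim s b a

/-- Gains from trade of an allocation: its welfare minus the pre-trade welfare. -/
def gainsFromTrade {mS mB : ℕ} (s : Fin mS → ℝ) (b : Fin mB → ℝ)
    (A : Finset (Fin mS ⊕ Fin mB)) : ℝ :=
  welfare s b A - ∑ i, s i

/-- The trade size of an allocation: the number of buyers who hold an item. -/
def tradeSize {mS mB : ℕ} (A : Finset (Fin mS ⊕ Fin mB)) : ℕ :=
  (Finset.univ.filter fun j : Fin mB => Sum.inr j ∈ A).card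

/-- The optimal gains from trade at the realized values. -/
def optGFT {mS mB : ℕ} (s : Fin mS → ℝ) (b : Fin mB → ℝ) : ℝ :=
  (allocations mS mB).sup' (allocations_nonempty mS mB) (gainsFromTrade s b)

/-- The optimal trade size `q`: the largest trade size of an optimal allocation. -/
def optTradeSize {mS mB : ℕ} (s : Fin mS → ℝ) (b : Fin mB → ℝ) : ℕ :=
  ((allocations mS mB).filter fun A => gainsFromTrade s b A = optGFT s b).sup tradeSize

/-- `sellerOrder s i` is the seller with the `(i + 1)`-st lowest value (ties by index). -/
def sellerOrder {mS : ℕ} (s : Fin mS → ℝ) : Equiv.Perm (Fin mS) :=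
  Tuple.sort s

/-- `buyerOrder b i` is the buyer with the `(i + 1)`-st highest value (ties by index). -/
def buyerOrder {mB : ℕ} (b : Fin mB → ℝ) : Equiv.Perm (Fin mB) :=
  Tuple.sort fun j => -b j

/-- The value of the next buyer in line is acceptable to all optimally trading sellers:
`b⁽q⁺¹⁾ ≥ s⁽q⁾`, where `q` is the optimal trade size. It fails if there are only `q` buyers.
(The order statistics are indexed from `0` here. For `q = 0` nothing is traded in either case.) -/
def PriceAccepted {mS mB : ℕ} (s : Fin mS → ℝ) (b : Fin mB → ℝ) : Prop :=
  ∃ (i : Fin mS) (j : Fin mB), (i : ℕ) + 1 = optTradeSize s b ∧ (j : ℕ) = optTradeSize s b ∧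
    s (sellerOrder s i) ≤ b (buyerOrder b j)

open Classical in
/-- The trade size of Buyer Trade Reduction: `q` if the price is accepted, otherwise `q - 1`
(and `0` if `q = 0`). -/
def btrTradeSize {mS mB : ℕ} (s : Fin mS → ℝ) (b : Fin mB → ℝ) : ℕ :=
  if PriceAccepted s b then optTradeSize s b else optTradeSize s b - 1

/-- The allocation chosen by Buyer Trade Reduction: with `t` its trade size, the `t` lowest-value
sellers give their items to the `t` highest-value buyers. Payments are transfers
and do not enter the gains from trade. -/
def btrAllocation {mS mB : ℕ} (s : Fin mS → ℝ) (b : Fin mB → ℝ) :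
    Finset (Fin mS ⊕ Fin mB) :=
  (Finset.univ.filter fun i : Fin mS =>
      btrTradeSize s b ≤ (((sellerOrder s).symm i : Fin mS) : ℕ)).disjSum
    (Finset.univ.filter fun j : Fin mB =>
      (((buyerOrder b).symm j : Fin mB) : ℕ) < btrTradeSize s b)

/-- The gains from trade of Buyer Trade Reduction at the realized values. -/
def btrGFT {mS mB : ℕ} (s : Fin mS → ℝ) (b : Fin mB → ℝ) : ℝ :=
  gainsFromTrade s b (btrAllocation s b)

/-- The law of the values in a market with `mS` sellers and `mB` buyers: all values are
independent, the sellers' ones with distribution `FS`, the buyers' ones with distribution `FB`. -/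
def marketLaw (FS FB : Measure ℝ) (mS mB : ℕ) : Measure ((Fin mS → ℝ) × (Fin mB → ℝ)) :=
  (Measure.pi fun _ : Fin mS => FS).prod (Measure.pi fun _ : Fin mB => FB)

/-- Expected optimal gains from trade, as an element of `[0, ∞]`; the integrand is nonnegative. -/
def OPT (FS FB : Measure ℝ) (mS mB : ℕ) : ENNReal :=
  ∫⁻ v, ENNReal.ofReal (optGFT v.1 v.2) ∂(marketLaw FS FB mS mB)

/-- Expected gains from trade of Buyer Trade Reduction, as an element of `[0, ∞]`; the integrand
is nonnegative. -/
def BTR (FS FB : Measure ℝ) (mS mB : ℕ) : ENNReal :=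
  ∫⁻ v, ENNReal.ofReal (btrGFT v.1 v.2) ∂(marketLaw FS FB mS mB)

/-- The value `inf {v ∈ ℝ | Pr_{w ∼ F}[w ≤ v] ≥ q}` at quantile `q`, in `[-∞, ∞]`. -/
def quantileValue (F : Measure ℝ) (q : ℝ) : EReal :=
  sInf ((fun v : ℝ => (v : EReal)) '' {v : ℝ | q ≤ F.real (Set.Iic v)})

/-- `FB` first-order stochastically dominates `FS`. -/
def StochasticallyDominates (FB FS : Measure ℝ) : Prop :=
  ∀ q ∈ Set.Icc (0 : ℝ) 1, quantileValue FS q ≤ quantileValue FB q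

end DoubleAuction

end

/-! Bound both sides by sums over single sellers, then compare them price by price. Write f and g
for the distribution functions of buyers and sellers at v, and k for `mB`. The optimum is at most
what each seller would gain alone facing all k buyers; as the positive part of b - s is the length
of [s, b), seller i contributes the integral over v of g (1 - f^k) (`OPT_le_sum`). Conversely, give
each seller a private group of N = k + r + 1 of the n buyers. Realization by realization, BTR gains
at least as much as the separate reductions in which a seller trades with the best buyer of the
group provided that a second one accepts the seller's value (`sum_trades_le_btrGFT`, `sum_le_BTR`).
At price v the reduction loses the event that one buyer exceeds v while all others are below the
seller's value. Dominance bounds its probability (`setLIntegral_real_Iio_pow_le`), and the extra r +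
1 buyers make up for it once 2k ≤ r(r + 1) (`trade_probability_le`). This is why about √k extra
buyers per seller suffice (`exists_group_size`). -/

namespace DoubleAuction

/-! ### Order statistics and threshold sums -/

/-- The indices of the `r` lowest values of `a` (ties by index). -/
noncomputable def lowest {n : ℕ} (a : Fin n → ℝ) (r : ℕ) : Finset (Fin n) :=
  Finset.univ.filter fun i => (((Tuple.sort a).symm i : Fin n) : ℕ) < r

theorem mem_lowest {n : ℕ} {a : Fin n → ℝ} {r : ℕ} {i : Fin n} :
    i ∈ lowest a r ↔ (((Tuple.sort a).symm i : Fin n) : ℕ) < r := by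
  simp [lowest]

theorem card_lowest {n : ℕ} (a : Fin n → ℝ) {r : ℕ} (hr : r ≤ n) : (lowest a r).card = r := by
  have h : lowest a r =
      (Finset.univ.filter fun i : Fin n => (i : ℕ) < r).map (Tuple.sort a).toEmbedding := by
    ext i
    simp only [mem_lowest, Finset.mem_map_equiv, Finset.mem_filter, Finset.mem_univ, true_and]
  rw [h, Finset.card_map, Fin.card_filter_val_lt, min_eq_right hr]

theorem le_sort_of_symm_le {n : ℕ} {a : Fin n → ℝ} {i x : Fin n}
    (h : (((Tuple.sort a).symm i : Fin n) : ℕ) ≤ x) : a i ≤ a (Tuple.sort a x) := by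
  have := Tuple.monotone_sort a (Fin.le_def.2 h)
  simpa using this

theorem sort_le_of_le_symm {n : ℕ} {a : Fin n → ℝ} {i x : Fin n}
    (h : (x : ℕ) ≤ (((Tuple.sort a).symm i : Fin n) : ℕ)) : a (Tuple.sort a x) ≤ a i := by
  have := Tuple.monotone_sort a (Fin.le_def.2 h)
  simpa using this

theorem lowest_succ {n : ℕ} (a : Fin n → ℝ) (x : Fin n) :
    lowest a (x + 1) = insert (Tuple.sort a x) (lowest a x) := by
  ext i
  rw [Finset.mem_insert, mem_lowest, mem_lowest, ← Equiv.symm_apply_eq, Fin.ext_iff]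
  omega

theorem sort_notMem_lowest {n : ℕ} (a : Fin n → ℝ) (x : Fin n) :
    Tuple.sort a x ∉ lowest a x := by
  simp [mem_lowest]

theorem sum_lowest_succ {n : ℕ} (a c : Fin n → ℝ) (x : Fin n) :
    ∑ i ∈ lowest a (x + 1), c i = c (Tuple.sort a x) + ∑ i ∈ lowest a x, c i := by
  rw [lowest_succ, Finset.sum_insert (sort_notMem_lowest a x)]

/-- Among all sums of `c - p`, the largest is the one over a set containing the positive terms
and none of the negative ones. -/
theorem sum_sub_le_of_threshold {ι : Type*} [DecidableEq ι] {c : ι → ℝ} {p : ℝ} {T : Finset ι}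
    (hT : ∀ x ∈ T, p ≤ c x) (hT' : ∀ x ∉ T, c x ≤ p) (A : Finset ι) :
    ∑ x ∈ A, (c x - p) ≤ ∑ x ∈ T, (c x - p) := by
  rw [← Finset.sum_inter_add_sum_sdiff A T]
  have h1 : ∑ x ∈ A ∩ T, (c x - p) ≤ ∑ x ∈ T, (c x - p) :=
    Finset.sum_le_sum_of_subset_of_nonneg Finset.inter_subset_right
      fun x hx _ => sub_nonneg.2 (hT x hx)
  have h2 : ∑ x ∈ A \ T, (c x - p) ≤ 0 :=
    Finset.sum_nonpos fun x hx => sub_nonpos.2 (hT' x (Finset.mem_sdiff.1 hx).2)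
  linarith

/-- Take the highest value among the lowest `A.card` as threshold; both sets have the same size, so
the threshold cancels. -/
theorem sum_lowest_le {n : ℕ} (a : Fin n → ℝ) (A : Finset (Fin n)) :
    ∑ i ∈ lowest a A.card, a i ≤ ∑ i ∈ A, a i := by
  have hA : A.card ≤ n := by simpa using A.card_le_univ
  rcases Nat.eq_zero_or_pos A.card with h0 | h0
  · rw [h0, Finset.card_eq_zero.1 h0]
    simp [lowest]
  obtain ⟨r, hr⟩ : ∃ r, A.card = r + 1 := ⟨A.card - 1, by omega⟩
  have hrn : r < n := by omega
  set p := a (Tuple.sort a ⟨r, hrn⟩) with hp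
  have h := sum_sub_le_of_threshold (c := fun i => -a i) (p := -p) (T := lowest a A.card)
    (fun x hx => neg_le_neg (le_sort_of_symm_le (by
      rw [mem_lowest] at hx; simp only; omega)))
    (fun x hx => neg_le_neg (sort_le_of_le_symm (by
      rw [mem_lowest] at hx; simp only; omega))) A
  simp only [Finset.sum_sub_distrib, Finset.sum_neg_distrib, Finset.sum_const,
    card_lowest a hA] at h
  linarith

/-! ### Allocations and efficient trades -/

theorem gainsFromTrade_disjSum {mS mB : ℕ} (s : Fin mS → ℝ) (b : Fin mB → ℝ)
    (S : Finset (Fin mS)) (B : Finset (Fin mB)) :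
    gainsFromTrade s b (Sᶜ.disjSum B) = ∑ j ∈ B, b j - ∑ i ∈ S, s i := by
  unfold gainsFromTrade welfare
  rw [Finset.sum_disjSum, ← Finset.sum_add_sum_compl S s]
  simp only [Sum.elim_inl, Sum.elim_inr]
  ring

theorem disjSum_mem_allocations {mS mB : ℕ} {S : Finset (Fin mS)} {B : Finset (Fin mB)}
    (h : S.card = B.card) : Sᶜ.disjSum B ∈ allocations mS mB := by
  have := S.card_le_univ
  rw [Fintype.card_fin] at this
  rw [allocations, Finset.mem_powersetCard, Finset.card_disjSum, Finset.card_compl,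
    Fintype.card_fin]
  exact ⟨Finset.subset_univ _, by omega⟩

/-- Every allocation arises by letting as many sellers as buyers trade. -/
theorem exists_eq_disjSum {mS mB : ℕ} {A : Finset (Fin mS ⊕ Fin mB)}
    (hA : A ∈ allocations mS mB) : ∃ (S : Finset (Fin mS)) (B : Finset (Fin mB)),
      S.card = B.card ∧ B.card = tradeSize A ∧ A = Sᶜ.disjSum B := by
  refine ⟨A.toLeftᶜ, A.toRight, ?_, ?_, ?_⟩
  · have h1 := (Finset.mem_powersetCard.1 hA).2
    have h2 := A.card_toLeft_add_card_toRight
    have h3 := A.toLeft.card_le_univ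
    rw [Fintype.card_fin] at h3
    rw [Finset.card_compl, Fintype.card_fin]
    omega
  · unfold tradeSize
    congr 1
    ext j
    simp
  · rw [compl_compl, Finset.toLeft_disjSum_toRight]

theorem gainsFromTrade_le_optGFT {mS mB : ℕ} (s : Fin mS → ℝ) (b : Fin mB → ℝ)
    {A : Finset (Fin mS ⊕ Fin mB)} (hA : A ∈ allocations mS mB) :
    gainsFromTrade s b A ≤ optGFT s b :=
  Finset.le_sup' (gainsFromTrade s b) hA

/-- The gains when the `r` lowest-value sellers trade with the `r` highest-value buyers. -/
noncomputable def efficientGains {mS mB : ℕ} (s : Fin mS → ℝ) (b : Fin mB → ℝ) (r : ℕ) : ℝ :=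
  ∑ j ∈ lowest (fun j => -b j) r, b j - ∑ i ∈ lowest s r, s i

theorem gainsFromTrade_le_efficientGains {mS mB : ℕ} (s : Fin mS → ℝ) (b : Fin mB → ℝ)
    {A : Finset (Fin mS ⊕ Fin mB)} (hA : A ∈ allocations mS mB) :
    gainsFromTrade s b A ≤ efficientGains s b (tradeSize A) := by
  obtain ⟨S, B, h, hB, rfl⟩ := exists_eq_disjSum hA
  rw [gainsFromTrade_disjSum, ← hB]
  have h1 := sum_lowest_le s S
  have h2 := sum_lowest_le (fun j => -b j) B
  simp only [Finset.sum_neg_distrib] at h2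
  rw [h] at h1
  unfold efficientGains
  linarith

theorem efficientGains_le_optGFT {mS mB : ℕ} (s : Fin mS → ℝ) (b : Fin mB → ℝ) {r : ℕ}
    (hS : r ≤ mS) (hB : r ≤ mB) : efficientGains s b r ≤ optGFT s b := by
  rw [efficientGains, ← gainsFromTrade_disjSum]
  refine gainsFromTrade_le_optGFT s b (disjSum_mem_allocations ?_)
  rw [card_lowest _ hS, card_lowest _ hB]

theorem btrGFT_eq {mS mB : ℕ} (s : Fin mS → ℝ) (b : Fin mB → ℝ) :
    btrGFT s b = efficientGains s b (btrTradeSize s b) := by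
  rw [efficientGains, ← gainsFromTrade_disjSum, btrGFT, btrAllocation]
  congr 2
  ext i
  rw [Finset.mem_compl, mem_lowest, not_lt, Finset.mem_filter]
  simp [sellerOrder]

theorem optTradeSize_spec {mS mB : ℕ} (s : Fin mS → ℝ) (b : Fin mB → ℝ) :
    optTradeSize s b ≤ mS ∧ optTradeSize s b ≤ mB ∧
      efficientGains s b (optTradeSize s b) = optGFT s b := by
  obtain ⟨A₀, hA₀, h₀⟩ := Finset.exists_mem_eq_sup' (allocations_nonempty mS mB)
    (gainsFromTrade s b)
  obtain ⟨A, hA, h⟩ := Finset.exists_mem_eq_sup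
    ((allocations mS mB).filter fun A => gainsFromTrade s b A = optGFT s b)
    ⟨A₀, Finset.mem_filter.2 ⟨hA₀, h₀.symm⟩⟩ tradeSize
  change optTradeSize s b = tradeSize A at h
  rw [Finset.mem_filter] at hA
  obtain ⟨S, B, hc, hB, hAe⟩ := exists_eq_disjSum hA.1
  have h1 : S.card ≤ mS := by simpa using S.card_le_univ
  have h2 : B.card ≤ mB := by simpa using B.card_le_univ
  have h3 : optTradeSize s b ≤ mS := by omega
  have h4 : optTradeSize s b ≤ mB := by omega
  refine ⟨h3, h4, le_antisymm (efficientGains_le_optGFT s b h3 h4) ?_⟩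
  rw [← hA.2, h]
  exact gainsFromTrade_le_efficientGains s b hA.1

/-! ### Comparison with separate trades at fixed values -/

/-- If each seller `i ∈ T` has two buyers of their own, `j i` and `j' i`, the latter accepting
the seller's value as a price, then Buyer Trade Reduction gains at least as much as
the trades between `i` and `j i`. -/
theorem sum_trades_le_btrGFT {mS mB : ℕ} (s : Fin mS → ℝ) (b : Fin mB → ℝ)
    (T : Finset (Fin mS)) (j j' : Fin mS → Fin mB) (hj : Set.InjOn j T)
    (hjj' : ∀ i ∈ T, ∀ i' ∈ T, j' i ≠ j i') (hs : ∀ i ∈ T, s i ≤ b (j' i)) :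
    ∑ i ∈ T, (b (j i) - s i) ≤ btrGFT s b := by
  classical
  have hU : (T.image j).card = T.card := Finset.card_image_of_injOn hj
  have hsum : ∀ c : Fin mB → ℝ, ∑ i ∈ T, c (j i) = ∑ x ∈ T.image j, c x := fun c =>
    (Finset.sum_image fun x hx y hy h => hj hx hy h).symm
  have hopt : ∑ i ∈ T, (b (j i) - s i) ≤ optGFT s b := by
    rw [Finset.sum_sub_distrib, hsum b, ← gainsFromTrade_disjSum]
    exact gainsFromTrade_le_optGFT s b (disjSum_mem_allocations hU.symm)
  obtain ⟨hqS, hqB, hq⟩ := optTradeSize_spec s b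
  rw [btrGFT_eq, btrTradeSize]
  split_ifs with hacc
  · rwa [hq]
  rcases Nat.eq_zero_or_pos (optTradeSize s b) with h0 | h0
  · rw [h0] at hq ⊢
    rwa [Nat.zero_sub, hq]
  obtain ⟨r, hr⟩ : ∃ r, optTradeSize s b = r + 1 := ⟨optTradeSize s b - 1, by omega⟩
  rw [hr] at hqS hqB hq
  rw [hr, Nat.add_sub_cancel]
  set B : Fin mB → ℝ := fun x => -b x with hB
  set xS : Fin mS := ⟨r, hqS⟩
  set xB : Fin mB := ⟨r, hqB⟩
  set p := s (Tuple.sort s xS) with hp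
  have hgain : efficientGains s b (r + 1) =
      efficientGains s b r + (b (Tuple.sort B xB) - p) := by
    have h1 := sum_lowest_succ s s xS
    have h2 := sum_lowest_succ B b xB
    change ∑ i ∈ lowest s (r + 1), s i = p + ∑ i ∈ lowest s r, s i at h1
    change ∑ i ∈ lowest B (r + 1), b i = _ + ∑ i ∈ lowest B r, b i at h2
    simp only [efficientGains, ← hB]
    linarith
  -- Otherwise dropping the last pair would beat the optimum.
  have hbp : p ≤ b (Tuple.sort B xB) := by
    have := efficientGains_le_optGFT s b (r := r) (by omega) (by omega)
    linarith
  have htop : ∀ x ∈ lowest B (r + 1), b (Tuple.sort B xB) ≤ b x := fun x hx =>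
    neg_le_neg_iff.1 (le_sort_of_symm_le (a := B) (x := xB)
      (Nat.lt_succ_iff.1 (mem_lowest.1 hx)))
  -- A buyer outside the top q = r + 1 is worth at most the next in line, who exists in this case
  -- and was refused at price p.
  have hout : ∀ x ∉ lowest B (r + 1), b x < p := by
    intro x hx
    rw [mem_lowest, not_lt] at hx
    have hn : r + 1 < mB := hx.trans_lt (Fin.is_lt _)
    have h1 : b x ≤ b (Tuple.sort B ⟨r + 1, hn⟩) :=
      neg_le_neg_iff.1 (sort_le_of_le_symm (a := B) (x := ⟨r + 1, hn⟩) hx)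
    by_contra! h2
    exact hacc ⟨xS, ⟨r + 1, hn⟩, by rw [hr], by rw [hr], h2.trans h1⟩
  have hlow : ∀ i ∈ lowest s r, s i ≤ p := fun i hi =>
    le_sort_of_symm_le (x := xS) (mem_lowest.1 hi).le
  have hlow' : ∀ i ∉ lowest s r, p ≤ s i := fun i hi =>
    sort_le_of_le_symm (x := xS) (not_lt.1 fun h => hi (mem_lowest.2 h))
  -- If all top q buyers were used as some `j i`, every `j' i` would lie outside them and be worth
  -- less than p. Then all of T would have values below p, forcing |T| ≤ r, although q = r + 1
  -- buyers are used.
  have hnot : ¬ lowest B (r + 1) ⊆ T.image j := by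
    intro hsub
    have hT : T ⊆ lowest s r := by
      intro i hi
      by_contra hi'
      have h1 : j' i ∉ lowest B (r + 1) := fun h => by
        obtain ⟨i', hi', h'⟩ := Finset.mem_image.1 (hsub h)
        exact hjj' i hi i' hi' h'.symm
      linarith [hlow' i hi', hs i hi, hout _ h1]
    have h1 := Finset.card_le_card hT
    have h2 := Finset.card_le_card hsub
    rw [card_lowest _ (by omega)] at h1 h2
    omega
  obtain ⟨x, hx, hxU⟩ := Finset.not_subset.1 hnot
  -- Adding the unused top buyer x keeps the sum within that of the top q; then remove x, worth at
  -- least the q-th buyer. So the r trades that remain already suffice.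
  have hbuy : ∑ y ∈ T.image j, (b y - p) ≤ ∑ y ∈ lowest B r, (b y - p) := by
    have h1 := sum_sub_le_of_threshold (c := b) (p := p) (T := lowest B (r + 1))
      (fun y hy => hbp.trans (htop y hy)) (fun y hy => (hout y hy).le) (insert x (T.image j))
    have h2 := sum_lowest_succ B (fun y => b y - p) xB
    change ∑ i ∈ lowest B (r + 1), (b i - p) = _ + ∑ i ∈ lowest B r, (b i - p) at h2
    rw [Finset.sum_insert hxU] at h1
    linarith [htop x hx]
  have hsell := sum_sub_le_of_threshold (c := fun i => -s i) (p := -p) (T := lowest s r)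
    (fun i hi => neg_le_neg (hlow i hi)) (fun i hi => neg_le_neg (hlow' i hi)) T
  have h1 := hsum b
  simp only [Finset.sum_sub_distrib, Finset.sum_neg_distrib, Finset.sum_const, hU,
    card_lowest s (show r ≤ mS by omega), card_lowest B (show r ≤ mB by omega)] at hbuy hsell
  rw [Finset.sum_sub_distrib, h1, efficientGains]
  simp only [nsmul_eq_mul] at hbuy hsell
  linarith

/-- The optimal gains from trade are at most those of each seller trading alone
with all the buyers. -/
theorem ofReal_optGFT_le {mS mB : ℕ} (s : Fin mS → ℝ) (b : Fin mB → ℝ) :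
    ENNReal.ofReal (optGFT s b) ≤ ∑ i, volume {v : ℝ | s i ≤ v ∧ ∃ j, v < b j} := by
  obtain ⟨A, hA, h⟩ := Finset.exists_mem_eq_sup' (allocations_nonempty mS mB)
    (gainsFromTrade s b)
  obtain ⟨S, B, hc, -, rfl⟩ := exists_eq_disjSum hA
  rw [optGFT, h, gainsFromTrade_disjSum]
  rcases B.eq_empty_or_nonempty with rfl | hne
  · rw [Finset.card_empty, Finset.card_eq_zero] at hc
    simp [hc]
  -- Every trading buyer is replaced by the best one, which decouples the sellers.
  obtain ⟨j, -, hj⟩ := Finset.exists_max_image B b hne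
  have h1 : ∑ x ∈ B, b x ≤ ∑ i ∈ S, b j := by
    rw [Finset.sum_const, hc]
    exact Finset.sum_le_card_nsmul _ _ _ hj
  calc ENNReal.ofReal (∑ x ∈ B, b x - ∑ i ∈ S, s i)
      ≤ ENNReal.ofReal (∑ i ∈ S, (b j - s i)) := by
        rw [Finset.sum_sub_distrib]
        exact ENNReal.ofReal_le_ofReal (by linarith)
    _ ≤ ∑ i ∈ S, ENNReal.ofReal (b j - s i) :=
        Finset.le_sum_of_subadditive _ ENNReal.ofReal_zero.le
          (fun _ _ => ENNReal.ofReal_add_le) _ _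
    _ ≤ ∑ i, ENNReal.ofReal (b j - s i) := Finset.sum_le_univ_sum_of_nonneg fun _ => zero_le
    _ ≤ ∑ i, volume {v : ℝ | s i ≤ v ∧ ∃ j, v < b j} := by
        refine Finset.sum_le_sum fun i _ => ?_
        rw [← Real.volume_Ico]
        exact measure_mono fun v hv => ⟨hv.1, j, hv.2⟩

/-- Buyer Trade Reduction gains at least as much as separate trade reductions between each
seller `i` and their own group `J i` of buyers. -/
theorem sum_volume_le_ofReal_btrGFT {mS mB : ℕ} (s : Fin mS → ℝ) (b : Fin mB → ℝ)
    (J : Fin mS → Finset (Fin mB)) (hJ : Pairwise fun i i' => Disjoint (J i) (J i')) :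
    ∑ i, volume {v : ℝ | s i ≤ v ∧ ∃ j ∈ J i, ∃ j' ∈ J i, j ≠ j' ∧ v < b j ∧ s i ≤ b j'} ≤
      ENNReal.ofReal (btrGFT s b) := by
  classical
  rcases isEmpty_or_nonempty (Fin mB) with hB | hB
  · simp
  let T : Finset (Fin mS) := Finset.univ.filter fun i =>
    ∃ j ∈ J i, ∃ j' ∈ J i, j ≠ j' ∧ s i ≤ b j ∧ s i ≤ b j'
  have hchoose : ∀ i, ∃ x y : Fin mB, i ∈ T →
      x ∈ J i ∧ y ∈ J i ∧ y ≠ x ∧ s i ≤ b y ∧ ∀ z ∈ J i, b z ≤ b x := by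
    intro i
    by_cases hi : i ∈ T
    · obtain ⟨j, hj, j', hj', hne, h, h'⟩ := (Finset.mem_filter.1 hi).2
      obtain ⟨x, hx, hmax⟩ := Finset.exists_max_image (J i) b ⟨j, hj⟩
      -- Of the two accepting buyers, at least one differs from the maximizer x; it serves as second
      -- buyer.
      by_cases hjx : j = x
      · exact ⟨x, j', fun _ => ⟨hx, hj', fun h => hne (hjx.trans h.symm), h', hmax⟩⟩
      · exact ⟨x, j, fun _ => ⟨hx, hj, hjx, h, hmax⟩⟩
    · exact ⟨hB.some, hB.some, fun h => absurd h hi⟩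
  choose x y hxy using hchoose
  have hdisj : ∀ i i' z, z ∈ J i → z ∈ J i' → i = i' := fun i i' z h h' => by
    by_contra hne
    exact Finset.disjoint_left.1 (hJ hne) h h'
  have hpos : ∀ i ∈ T, 0 ≤ b (x i) - s i := fun i hi => by
    obtain ⟨-, h2, -, h4, h5⟩ := hxy i hi
    linarith [h5 _ h2]
  have htrade := sum_trades_le_btrGFT s b T x y
    (fun i hi i' hi' h => hdisj i i' (x i) (hxy i hi).1 (h ▸ (hxy i' hi').1))
    (fun i hi i' hi' h => by
      obtain rfl := hdisj i i' (y i) (hxy i hi).2.1 (h ▸ (hxy i' hi').1)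
      exact (hxy i hi).2.2.1 h)
    (fun i hi => (hxy i hi).2.2.2.1)
  refine le_trans ?_ (ENNReal.ofReal_le_ofReal htrade)
  rw [ENNReal.ofReal_sum_of_nonneg hpos]
  have hzero : ∀ i ∉ T,
      volume {v : ℝ | s i ≤ v ∧ ∃ j ∈ J i, ∃ j' ∈ J i, j ≠ j' ∧ v < b j ∧ s i ≤ b j'} = 0 := by
    intro i hi
    refine measure_mono_null (t := ∅) ?_ measure_empty
    rintro v ⟨h1, j, hj, j', hj', hne, h2, h3⟩
    exact hi (Finset.mem_filter.2 ⟨Finset.mem_univ i, j, hj, j', hj', hne, h1.trans h2.le, h3⟩)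
  rw [← Finset.sum_subset (Finset.subset_univ T) fun i _ hi => hzero i hi]
  refine Finset.sum_le_sum fun i hi => ?_
  rw [← Real.volume_Ico]
  refine measure_mono ?_
  rintro v ⟨h1, j, hj, -, -, -, h2, -⟩
  exact ⟨h1, h2.trans_le ((hxy i hi).2.2.2.2 j hj)⟩

/-! ### Polynomial inequalities -/

/-- The left side does not increase with n: the decrease from n to n + 1 is x^n (n + 1)(1 - x)². -/
theorem pow_mul_one_add_le {x : ℝ} (h0 : 0 ≤ x) (n : ℕ) :
    x ^ n * (1 + n * (1 - x)) ≤ 1 := by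
  induction n with
  | zero => simp
  | succ n ih =>
    refine le_trans ?_ ih
    rw [pow_succ, mul_assoc]
    refine mul_le_mul_of_nonneg_left ?_ (pow_nonneg h0 n)
    push_cast
    nlinarith [mul_nonneg (Nat.cast_nonneg (α := ℝ) n) (sq_nonneg (1 - x))]

/-- Termwise, x^i is at least x^r (1 + (r - i)(1 - x)); the weights r - i add up to r(r + 1)/2. -/
theorem pow_mul_le_geom_sum {x : ℝ} (h0 : 0 ≤ x) (r : ℕ) :
    x ^ r * (r + r * (r + 1) / 2 * (1 - x)) ≤ ∑ i ∈ Finset.range r, x ^ i := by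
  induction r with
  | zero => simp
  | succ r ih =>
    have hb := pow_mul_one_add_le h0 (r + 1)
    have hx := mul_le_mul_of_nonneg_left ih h0
    rw [Finset.sum_range_succ', Finset.sum_congr rfl fun i _ => pow_succ' x i, ← Finset.mul_sum,
      pow_zero]
    push_cast at hb ⊢
    rw [pow_succ] at hb ⊢
    linarith

/-- The inequality between the trade probabilities at a fixed price. -/
theorem trade_probability_le {f g : ℝ} (hf : 0 ≤ f) (hf1 : f ≤ 1) (hg : 0 ≤ g) (hg1 : g ≤ 1)
    {k r : ℕ} (hr : 2 * (k : ℝ) ≤ r * (r + 1)) :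
    g * (1 - f ^ k) ≤ g * (1 - f ^ (k + r + 1)) -
      (1 - f) * ((k + r + 1) * g * f ^ (k + r) - (k + r) * f ^ (k + r + 1)) := by
  have hy : 0 ≤ 1 - f := sub_nonneg.2 hf1
  have hfr := pow_nonneg hf r
  have hgeom := geom_sum_mul_neg f (r + 1)
  rw [Finset.sum_range_succ] at hgeom
  set S := ∑ i ∈ Finset.range r, f ^ i
  have hS : f ^ r * ((k + r) * (1 - f)) ≤ S := by
    refine le_trans (mul_le_mul_of_nonneg_left ?_ hfr) (pow_mul_le_geom_sum hf r)
    nlinarith [mul_nonneg (Nat.cast_nonneg (α := ℝ) r) hf, mul_nonneg (sub_nonneg.2 hr) hy]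
  -- The claim divided by f^k (1 - f). It is affine in g, so when the slope is negative the worst
  -- case is g = 1, which is `hS`.
  have hmain : 0 ≤ g * (S - (k + r) * f ^ r) + (k + r) * f ^ (r + 1) := by
    have hB : 0 ≤ (k + r : ℝ) * f ^ (r + 1) := by positivity
    rcases le_total 0 (S - (k + r) * f ^ r) with h | h
    · exact add_nonneg (mul_nonneg hg h) hB
    · have : f ^ (r + 1) = f ^ r * f := pow_succ f r
      nlinarith [mul_le_mul_of_nonpos_right hg1 h]
  have := mul_nonneg (mul_nonneg (pow_nonneg hf k) hy) hmain
  have e1 : f ^ (k + r + 1) = f ^ k * f ^ (r + 1) := by ring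
  have e2 : f ^ (k + r) = f ^ k * f ^ r := by ring
  have e3 : f ^ k * (1 - f ^ (r + 1)) = f ^ k * ((S + f ^ r) * (1 - f)) := by rw [hgeom]
  rw [e1, e2]
  have e4 : g * (1 - f ^ k * f ^ (r + 1)) = g * (1 - f ^ k) + g * (f ^ k * (1 - f ^ (r + 1))) := by
    ring
  rw [e4, e3]
  nlinarith

/-! ### Consequences of stochastic dominance -/

/-- At level q = FB(v) the quantile of FB, hence that of FS, is at most v. So FS(x) ≥ q for all x >
v, and right continuity gives x = v. -/
theorem real_Iic_le_of_stochasticallyDominates {FS FB : Measure ℝ} [IsProbabilityMeasure FS]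
    [IsProbabilityMeasure FB] (hdom : StochasticallyDominates FB FS) (v : ℝ) :
    FB.real (Set.Iic v) ≤ FS.real (Set.Iic v) := by
  have hq : quantileValue FB (FB.real (Set.Iic v)) ≤ (v : EReal) := 
    sInf_le ⟨v, le_refl (FB.real (Set.Iic v)), rfl⟩
  have hS := (hdom _ ⟨measureReal_nonneg, measureReal_le_one⟩).trans hq
  have hlim : Filter.Tendsto (fun x => FS.real (Set.Iic x)) (nhdsWithin v (Set.Ioi v))
      (nhds (FS.real (Set.Iic v))) := by
    simp only [← ProbabilityTheory.cdf_eq_real]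
    exact ((ProbabilityTheory.cdf FS).right_continuous v).mono_left
      (nhdsWithin_mono v Set.Ioi_subset_Ici_self)
  refine ge_of_tendsto hlim (Filter.eventually_of_mem self_mem_nhdsWithin fun x hx => ?_)
  obtain ⟨-, ⟨w, hw, rfl⟩, hwx⟩ := sInf_lt_iff.1 (hS.trans_lt (EReal.coe_lt_coe_iff.2 hx))
  exact le_trans hw (measureReal_mono (Set.Iic_subset_Iic.2 (EReal.coe_lt_coe_iff.1 hwx).le))

theorem real_Iio_le_of_real_Iic_le {μ ν : Measure ℝ} [IsProbabilityMeasure μ]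
    [IsProbabilityMeasure ν] (h : ∀ v, μ.real (Set.Iic v) ≤ ν.real (Set.Iic v)) (x : ℝ) :
    μ.real (Set.Iio x) ≤ ν.real (Set.Iio x) := by
  by_contra! hlt
  have hlt' : ν (Set.Iio x) < μ (Set.Iio x) :=
    (ENNReal.toReal_lt_toReal (measure_ne_top _ _) (measure_ne_top _ _)).1 hlt
  obtain ⟨K, hK, hKc, hKlt⟩ := measurableSet_Iio.exists_lt_isCompact hlt'
  rcases K.eq_empty_or_nonempty with rfl | hne
  · simp at hKlt
  obtain ⟨y, hy, hmax⟩ := hKc.exists_isGreatest hne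
  have h1 : μ K ≤ μ (Set.Iic y) := measure_mono hmax
  have h2 : μ (Set.Iic y) ≤ ν (Set.Iic y) :=
    (ENNReal.toReal_le_toReal (measure_ne_top _ _) (measure_ne_top _ _)).1 (h y)
  have h3 : ν (Set.Iic y) ≤ ν (Set.Iio x) := measure_mono (Set.Iic_subset_Iio.2 (hK hy))
  exact absurd (h1.trans (h2.trans h3)) hKlt.not_ge

/-- The set is an upper part of (-∞, v]. Inner regularity by compact sets supplies a least point y,
and then ν[y, v] ≤ ν(Iic v) - μ(Iio y), which is below ν(Iic v) - t. Atoms are thereby allowed. -/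
theorem measure_lt_real_Iio_le {μ ν : Measure ℝ} [IsProbabilityMeasure μ]
    [IsProbabilityMeasure ν] (h : ∀ v, μ.real (Set.Iic v) ≤ ν.real (Set.Iic v))
    (t v : ℝ) :
    (ν.restrict (Set.Iic v)) {x | t < μ.real (Set.Iio x)} ≤
      ENNReal.ofReal (ν.real (Set.Iic v) - t) := by
  have hmono : Monotone fun x => μ.real (Set.Iio x) := fun x y hxy =>
    measureReal_mono (Set.Iio_subset_Iio hxy)
  have hms : MeasurableSet {x | t < μ.real (Set.Iio x)} :=
    measurableSet_lt measurable_const hmono.measurable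
  rw [Measure.restrict_apply hms]
  by_contra! hlt
  obtain ⟨K, hK, hKc, hKlt⟩ := (hms.inter measurableSet_Iic).exists_lt_isCompact hlt
  rcases K.eq_empty_or_nonempty with rfl | hne
  · simp at hKlt
  obtain ⟨y, hy, hmin⟩ := hKc.exists_isLeast hne
  have hKs : K ⊆ Set.Iic v \ Set.Iio y := fun z hz => ⟨(hK hz).2, not_lt.2 (hmin hz)⟩
  have hyv : y ≤ v := (hK hy).2
  refine absurd ?_ hKlt.not_ge
  refine (measure_mono hKs).trans ?_
  rw [← ofReal_measureReal, measureReal_sdiff (Set.Iio_subset_Iic hyv) measurableSet_Iio]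
  have h1 : t < μ.real (Set.Iio y) := (hK hy).1
  have h2 := real_Iio_le_of_real_Iic_le h y
  exact ENNReal.ofReal_le_ofReal (by linarith)

/-- If `μ` stochastically dominates `ν` then the probability that a draw from `ν` is at most `v`
and exceeds `M` independent draws from `μ` is controlled by the distribution functions at `v`. -/
theorem setLIntegral_real_Iio_pow_le {μ ν : Measure ℝ} [IsProbabilityMeasure μ]
    [IsProbabilityMeasure ν] (h : ∀ v, μ.real (Set.Iic v) ≤ ν.real (Set.Iic v)) (v : ℝ) (M : ℕ) :
    ∫⁻ x in Set.Iic v, ENNReal.ofReal (μ.real (Set.Iio x) ^ M) ∂ν ≤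
      ENNReal.ofReal (ν.real (Set.Iic v) * μ.real (Set.Iic v) ^ M -
        M / (M + 1) * μ.real (Set.Iic v) ^ (M + 1)) := by
  set f := μ.real (Set.Iic v) with hf
  set g := ν.real (Set.Iic v) with hg
  have hf0 : 0 ≤ f := measureReal_nonneg
  have hfg : f ≤ g := h v
  -- The layer-cake density M t^(M - 1) represents x^M only for M ≥ 1.
  rcases Nat.eq_zero_or_pos M with rfl | hM
  · simp [hg]
  have hmono : Monotone fun x => μ.real (Set.Iio x) := fun x y hxy =>
    measureReal_mono (Set.Iio_subset_Iio hxy)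
  have hM' : (M : ℝ) ≠ 0 := by positivity
  have hint : ∀ x : ℝ, x ^ M = ∫ t in (0 : ℝ)..x, M * t ^ (M - 1) := fun x => by
    rw [intervalIntegral.integral_const_mul, integral_pow, Nat.sub_add_cancel hM,
      zero_pow hM.ne', Nat.cast_sub hM]
    simp only [Nat.cast_one, sub_add_cancel, sub_zero]
    exact (mul_div_cancel₀ _ hM').symm
  have hlayer := lintegral_comp_eq_lintegral_meas_lt_mul (ν.restrict (Set.Iic v))
    (f := fun x => μ.real (Set.Iio x)) (g := fun t => (M : ℝ) * t ^ (M - 1))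
    (Filter.Eventually.of_forall fun x => measureReal_nonneg) hmono.measurable.aemeasurable
    (fun t _ => (by fun_prop : Continuous fun t : ℝ => (M : ℝ) * t ^ (M - 1)).intervalIntegrable _ _)
    ((ae_restrict_iff' measurableSet_Ioi).2 (Filter.Eventually.of_forall fun t ht => by
      have : (0 : ℝ) < t := ht
      positivity))
  simp only [← hint] at hlayer
  rw [hlayer]
  have hcont : Continuous fun t : ℝ => (g - t) * (M * t ^ (M - 1)) := by fun_prop
  calc ∫⁻ t in Set.Ioi 0, (ν.restrict (Set.Iic v)) {x | t < μ.real (Set.Iio x)} *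
        ENNReal.ofReal (M * t ^ (M - 1))
      ≤ ∫⁻ t in Set.Ioi 0, (Set.Ioc 0 f).indicator
          (fun t => ENNReal.ofReal ((g - t) * (M * t ^ (M - 1)))) t := by
        refine setLIntegral_mono' measurableSet_Ioi fun t ht => ?_
        have ht : 0 < t := ht
        by_cases htf : t ≤ f
        · rw [Set.indicator_of_mem (Set.mem_Ioc.2 ⟨ht, htf⟩), ENNReal.ofReal_mul (p := g - t) (by linarith)]
          exact mul_le_mul' (measure_lt_real_Iio_le h t v) le_rfl
        · have : (ν.restrict (Set.Iic v)) {x | t < μ.real (Set.Iio x)} = 0 := by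
            rw [Measure.restrict_apply (measurableSet_lt measurable_const hmono.measurable)]
            refine measure_mono_null (t := ∅) ?_ measure_empty
            rintro x ⟨hx, hxv⟩
            have : μ.real (Set.Iio x) ≤ f := measureReal_mono
              (Set.Iio_subset_Iic_self.trans (Set.Iic_subset_Iic.2 hxv))
            exact htf (le_of_lt (lt_of_lt_of_le hx this))
          rw [this, zero_mul]
          exact zero_le
    _ = ∫⁻ t in Set.Ioc 0 f, ENNReal.ofReal ((g - t) * (M * t ^ (M - 1))) := by
        rw [lintegral_indicator measurableSet_Ioc, Measure.restrict_restrict measurableSet_Ioc,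
          Set.inter_eq_left.2 Set.Ioc_subset_Ioi_self]
    _ = ENNReal.ofReal (∫ t in (0 : ℝ)..f, (g - t) * (M * t ^ (M - 1))) := by
        rw [intervalIntegral.integral_of_le hf0, ofReal_integral_eq_lintegral_ofReal]
        · exact hcont.integrableOn_Ioc
        · refine (ae_restrict_iff' measurableSet_Ioc).2 (Filter.Eventually.of_forall fun t ht => ?_)
          have h1 : 0 ≤ g - t := by linarith [ht.2]
          have h2 : 0 ≤ t := ht.1.le
          positivity
    _ = ENNReal.ofReal (g * f ^ M - M / (M + 1) * f ^ (M + 1)) := by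
        congr 1
        have e : ∀ t : ℝ, (g - t) * (M * t ^ (M - 1)) = g * (M * t ^ (M - 1)) - M * t ^ M :=
          fun t => by
            rw [← Nat.sub_add_cancel hM, pow_succ]
            simp
            ring
        simp only [e]
        rw [intervalIntegral.integral_sub
          ((by fun_prop : Continuous fun t : ℝ => g * (M * t ^ (M - 1))).intervalIntegrable _ _)
          ((by fun_prop : Continuous fun t : ℝ => (M : ℝ) * t ^ M).intervalIntegrable _ _),
          intervalIntegral.integral_const_mul, ← hint, intervalIntegral.integral_const_mul,
          integral_pow]
        simp
        ring

/-! ### Trade probabilities at a fixed price -/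

instance isProbabilityMeasure_marketLaw (FS FB : Measure ℝ) [IsProbabilityMeasure FS]
    [IsProbabilityMeasure FB] (mS mB : ℕ) : IsProbabilityMeasure (marketLaw FS FB mS mB) := by
  unfold marketLaw
  infer_instance

theorem pi_setOf_forall_mem {n : ℕ} (F : Measure ℝ) [IsProbabilityMeasure F]
    (J : Finset (Fin n)) (A : Fin n → Set ℝ) :
    (Measure.pi fun _ : Fin n => F) {b | ∀ j ∈ J, b j ∈ A j} = ∏ j ∈ J, F (A j) :=
  Measure.pi_pi_finset (fun _ => F) A J

/-- Tonelli: expected lengths become integrals over the price v of probabilities. -/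
theorem lintegral_sum_volume_eq {Ω ι : Type*} [MeasurableSpace Ω] [Fintype ι] (μ : Measure Ω)
    [SFinite μ] {E : ι → Set (Ω × ℝ)} (hE : ∀ i, MeasurableSet (E i)) :
    ∫⁻ ω, ∑ i, volume {v | (ω, v) ∈ E i} ∂μ = ∑ i, ∫⁻ v, μ {ω | (ω, v) ∈ E i} :=
  (lintegral_finsetSum _ fun i _ => measurable_measure_prodMk_left (hE i)).trans <|
    Finset.sum_congr rfl fun i _ =>
      (Measure.prod_apply (hE i)).symm.trans (Measure.prod_apply_symm (hE i))

section

variable (FS FB : Measure ℝ) [IsProbabilityMeasure FS] [IsProbabilityMeasure FB] {mS mB : ℕ}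

/-- The probability that the price `v` is acceptable to seller `i` and to a buyer in `J`. -/
theorem marketLaw_trade (i : Fin mS) (J : Finset (Fin mB)) (v : ℝ) :
    (marketLaw FS FB mS mB).real {w | w.1 i ≤ v ∧ ∃ j ∈ J, v < w.2 j} =
      FS.real (Set.Iic v) * (1 - FB.real (Set.Iic v) ^ J.card) := by
  have hset : {w : (Fin mS → ℝ) × (Fin mB → ℝ) | w.1 i ≤ v ∧ ∃ j ∈ J, v < w.2 j} =
      {s | ∀ i' ∈ ({i} : Finset (Fin mS)), s i' ∈ Set.Iic v} ×ˢ
        {b | ∀ j ∈ J, b j ∈ Set.Iic v}ᶜ := by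
    ext w
    simp
  have hm : MeasurableSet {b : Fin mB → ℝ | ∀ j ∈ J, b j ∈ Set.Iic v} := by
    simp only [Set.ofPred_forall]
    exact Finset.measurableSet_biInter J fun j _ => measurable_pi_apply j measurableSet_Iic
  rw [hset, marketLaw, measureReal_prod_prod, probReal_compl_eq_one_sub hm]
  simp only [measureReal_def, pi_setOf_forall_mem FS, pi_setOf_forall_mem FB]
  simp

/-- The probability that the price `v` is acceptable to seller `i` and to buyer `j`, while
no other buyer in `J` accepts the seller's value as a price. -/
theorem marketLaw_blocked_le (hF : ∀ v, FB.real (Set.Iic v) ≤ FS.real (Set.Iic v)) (i : Fin mS)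
    (J : Finset (Fin mB)) {j : Fin mB} (hj : j ∈ J) (v : ℝ) {M : ℕ} (hM : J.card = M + 1) :
    (marketLaw FS FB mS mB).real
        {w | w.1 i ≤ v ∧ v < w.2 j ∧ ∀ j' ∈ J, j' ≠ j → w.2 j' < w.1 i} ≤
      (1 - FB.real (Set.Iic v)) * (FS.real (Set.Iic v) * FB.real (Set.Iic v) ^ M -
        M / (M + 1) * FB.real (Set.Iic v) ^ (M + 1)) := by
  set f := FB.real (Set.Iic v) with hf
  set g := FS.real (Set.Iic v) with hg
  have hf0 : 0 ≤ f := measureReal_nonneg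
  have hf1 : f ≤ 1 := measureReal_le_one
  have hfg : f ≤ g := hF v
  have hnn : 0 ≤ g * f ^ M - M / (M + 1) * f ^ (M + 1) := by
    have h1 : (M / (M + 1) : ℝ) ≤ 1 := (div_le_one (by positivity)).2 (by linarith)
    have h2 : f ^ (M + 1) ≤ g * f ^ M := by
      rw [pow_succ']
      exact mul_le_mul_of_nonneg_right hfg (pow_nonneg hf0 M)
    have h3 := mul_le_mul_of_nonneg_right h1 (pow_nonneg hf0 (M + 1))
    linarith
  have hm : MeasurableSet {w : (Fin mS → ℝ) × (Fin mB → ℝ) |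
      w.1 i ≤ v ∧ v < w.2 j ∧ ∀ j' ∈ J, j' ≠ j → w.2 j' < w.1 i} := by
    have hs : Measurable fun w : (Fin mS → ℝ) × (Fin mB → ℝ) => w.1 i := by fun_prop
    have hb : ∀ x, Measurable fun w : (Fin mS → ℝ) × (Fin mB → ℝ) => w.2 x := by fun_prop
    refine (measurableSet_le hs measurable_const).inter
      ((measurableSet_lt measurable_const (hb j)).inter ?_)
    change MeasurableSet {w : (Fin mS → ℝ) × (Fin mB → ℝ) | ∀ j' ∈ J, j' ≠ j → w.2 j' < w.1 i}
    simp only [Set.ofPred_forall]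
    exact Finset.measurableSet_biInter J fun j' _ => MeasurableSet.iInter fun _ =>
      measurableSet_lt (hb j') hs
  have hsec : ∀ s : Fin mS → ℝ, (Measure.pi fun _ : Fin mB => FB)
      (Prod.mk s ⁻¹' {w | w.1 i ≤ v ∧ v < w.2 j ∧ ∀ j' ∈ J, j' ≠ j → w.2 j' < w.1 i}) =
      (Set.Iic v).indicator
        (fun x => ENNReal.ofReal (1 - f) * ENNReal.ofReal (FB.real (Set.Iio x) ^ M)) (s i) := by
    intro s
    by_cases hs : s i ≤ v
    · have hset : Prod.mk s ⁻¹' {w : (Fin mS → ℝ) × (Fin mB → ℝ) |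
          w.1 i ≤ v ∧ v < w.2 j ∧ ∀ j' ∈ J, j' ≠ j → w.2 j' < w.1 i} =
          {b | ∀ x ∈ J, b x ∈ if x = j then (Set.Iic v)ᶜ else Set.Iio (s i)} := by
        ext b
        simp only [Set.mem_preimage, Set.mem_ofPred_eq, hs, true_and]
        constructor
        · rintro ⟨h1, h2⟩ x hx
          split_ifs with hxj
          · simpa [hxj] using h1
          · exact h2 x hx hxj
        · intro h
          refine ⟨by simpa using h j hj, fun x hx hxj => ?_⟩
          simpa [hxj] using h x hx
      rw [hset, pi_setOf_forall_mem, Set.indicator_of_mem (Set.mem_Iic.2 hs),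
        ← Finset.mul_prod_erase J _ hj, if_pos rfl,
        Finset.prod_congr rfl fun x hx => by rw [if_neg (Finset.ne_of_mem_erase hx)],
        Finset.prod_const, Finset.card_erase_of_mem hj, hM, Nat.add_sub_cancel,
        ENNReal.ofReal_pow measureReal_nonneg, ofReal_measureReal,
        ← ofReal_measureReal (μ := FB) (s := (Set.Iic v)ᶜ),
        probReal_compl_eq_one_sub measurableSet_Iic]
    · rw [Set.indicator_of_notMem (by simpa using hs)]
      refine measure_mono_null (t := ∅) (fun b hb => hs hb.1) measure_empty
  have hmono : Monotone fun x => FB.real (Set.Iio x) := fun x y hxy =>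
    measureReal_mono (Set.Iio_subset_Iio hxy)
  refine ENNReal.toReal_le_of_le_ofReal (mul_nonneg (sub_nonneg.2 hf1) hnn) ?_
  have hmeas : Measurable fun x => ENNReal.ofReal (FB.real (Set.Iio x) ^ M) :=
    (hmono.measurable.pow_const M).ennreal_ofReal
  rw [marketLaw, Measure.prod_apply hm, lintegral_congr hsec,
    (measurePreserving_eval (fun _ : Fin mS => FS) i).lintegral_comp
      (f := (Set.Iic v).indicator fun x =>
        ENNReal.ofReal (1 - f) * ENNReal.ofReal (FB.real (Set.Iio x) ^ M))
      ((hmeas.const_mul _).indicator measurableSet_Iic),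
    lintegral_indicator measurableSet_Iic, lintegral_const_mul _ hmeas,
    ENNReal.ofReal_mul (sub_nonneg.2 hf1)]
  exact mul_le_mul_right (setLIntegral_real_Iio_pow_le hF v M) _

/-- With enough buyers in `J`, the price `v` is at least as likely to be traded at when the second
buyer in line is required to accept the seller's value as with `k` buyers and no reduction. -/
theorem le_marketLaw_reduced (hF : ∀ v, FB.real (Set.Iic v) ≤ FS.real (Set.Iic v)) (i : Fin mS)
    (J : Finset (Fin mB)) (v : ℝ) {k r : ℕ} (hr : 2 * k ≤ r * (r + 1))
    (hJ : J.card = k + r + 1) :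
    FS.real (Set.Iic v) * (1 - FB.real (Set.Iic v) ^ k) ≤
      (marketLaw FS FB mS mB).real
        {w | w.1 i ≤ v ∧ ∃ j ∈ J, ∃ j' ∈ J, j ≠ j' ∧ v < w.2 j ∧ w.1 i ≤ w.2 j'} := by
  set μ := marketLaw FS FB mS mB
  set R := {w : (Fin mS → ℝ) × (Fin mB → ℝ) |
    w.1 i ≤ v ∧ ∃ j ∈ J, ∃ j' ∈ J, j ≠ j' ∧ v < w.2 j ∧ w.1 i ≤ w.2 j'}
  -- If some buyer exceeds v but the reduced trade fails, that buyer is the only one accepting the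
  -- seller's value.
  have hcover : {w : (Fin mS → ℝ) × (Fin mB → ℝ) | w.1 i ≤ v ∧ ∃ j ∈ J, v < w.2 j} ⊆
      R ∪ ⋃ j ∈ J, {w | w.1 i ≤ v ∧ v < w.2 j ∧ ∀ j' ∈ J, j' ≠ j → w.2 j' < w.1 i} := by
    rintro w ⟨h1, j, hj, h2⟩
    by_cases h : ∃ j' ∈ J, j ≠ j' ∧ w.1 i ≤ w.2 j'
    · obtain ⟨j', hj', hne, h3⟩ := h
      exact Or.inl ⟨h1, j, hj, j', hj', hne, h2, h3⟩
    · push Not at h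
      exact Or.inr (Set.mem_biUnion hj ⟨h1, h2, fun j' hj' hne => h j' hj' hne.symm⟩)
  have h1 := (measureReal_mono hcover (measure_ne_top μ _)).trans (measureReal_union_le _ _)
  have h2 := measureReal_biUnion_finset_le (μ := μ) J fun j =>
    {w | w.1 i ≤ v ∧ v < w.2 j ∧ ∀ j' ∈ J, j' ≠ j → w.2 j' < w.1 i}
  have h3 := Finset.sum_le_card_nsmul J _ _ fun j hj =>
    marketLaw_blocked_le FS FB hF i J hj v (M := k + r) hJ
  have h4 := trade_probability_le (f := FB.real (Set.Iic v)) (g := FS.real (Set.Iic v))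
    measureReal_nonneg measureReal_le_one measureReal_nonneg measureReal_le_one (k := k) (r := r)
    (by exact_mod_cast hr)
  rw [marketLaw_trade FS FB i J v, hJ] at h1
  have h5 := h1.trans (add_le_add_right (h2.trans h3) _)
  rw [hJ, nsmul_eq_mul] at h5
  push_cast at h5
  have h6 : ∀ f g y : ℝ, ((k : ℝ) + r + 1) * (y * (g * f ^ (k + r) -
      (k + r) / (k + r + 1) * f ^ (k + r + 1))) =
      y * ((k + r + 1) * g * f ^ (k + r) - (k + r) * f ^ (k + r + 1)) := fun f g y => by
    have : (k : ℝ) + r + 1 ≠ 0 := by positivity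
    field_simp
  rw [h6] at h5
  linarith

/-! ### Integration over prices -/

theorem OPT_le_sum :
    OPT FS FB mS mB ≤ ∑ i : Fin mS, ∫⁻ v,
      (marketLaw FS FB mS mB) {w | w.1 i ≤ v ∧ ∃ j ∈ (Finset.univ : Finset (Fin mB)), v < w.2 j} := by
  have hm : ∀ i : Fin mS, MeasurableSet {p : ((Fin mS → ℝ) × (Fin mB → ℝ)) × ℝ |
      p.1.1 i ≤ p.2 ∧ ∃ j ∈ (Finset.univ : Finset (Fin mB)), p.2 < p.1.2 j} := fun i => by
    have hs : Measurable fun p : ((Fin mS → ℝ) × (Fin mB → ℝ)) × ℝ => p.1.1 i := by fun_prop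
    have hb : ∀ x, Measurable fun p : ((Fin mS → ℝ) × (Fin mB → ℝ)) × ℝ => p.1.2 x := by fun_prop
    refine (measurableSet_le hs measurable_snd).inter ?_
    change MeasurableSet {p : ((Fin mS → ℝ) × (Fin mB → ℝ)) × ℝ | ∃ j ∈ Finset.univ, p.2 < p.1.2 j}
    simp only [Set.ofPred_exists, Finset.mem_univ, true_and]
    exact MeasurableSet.iUnion fun j => measurableSet_lt measurable_snd (hb j)
  calc OPT FS FB mS mB
      ≤ ∫⁻ w, ∑ i, volume {v : ℝ | w.1 i ≤ v ∧ ∃ j ∈ (Finset.univ : Finset (Fin mB)), v < w.2 j}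
          ∂(marketLaw FS FB mS mB) := lintegral_mono fun w => by
        simpa using ofReal_optGFT_le w.1 w.2
    _ = _ := lintegral_sum_volume_eq _ hm

theorem sum_le_BTR (J : Fin mS → Finset (Fin mB))
    (hJ : Pairwise fun i i' => Disjoint (J i) (J i')) :
    ∑ i : Fin mS, ∫⁻ v, (marketLaw FS FB mS mB)
      {w | w.1 i ≤ v ∧ ∃ j ∈ J i, ∃ j' ∈ J i, j ≠ j' ∧ v < w.2 j ∧ w.1 i ≤ w.2 j'} ≤
      BTR FS FB mS mB := by
  have hm : ∀ i : Fin mS, MeasurableSet {p : ((Fin mS → ℝ) × (Fin mB → ℝ)) × ℝ |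
      p.1.1 i ≤ p.2 ∧ ∃ j ∈ J i, ∃ j' ∈ J i, j ≠ j' ∧ p.2 < p.1.2 j ∧ p.1.1 i ≤ p.1.2 j'} :=
    fun i => by
      have hs : Measurable fun p : ((Fin mS → ℝ) × (Fin mB → ℝ)) × ℝ => p.1.1 i := by fun_prop
      have hb : ∀ x, Measurable fun p : ((Fin mS → ℝ) × (Fin mB → ℝ)) × ℝ => p.1.2 x := by
        fun_prop
      refine (measurableSet_le hs measurable_snd).inter ?_
      change MeasurableSet {p : ((Fin mS → ℝ) × (Fin mB → ℝ)) × ℝ |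
        ∃ j ∈ J i, ∃ j' ∈ J i, j ≠ j' ∧ p.2 < p.1.2 j ∧ p.1.1 i ≤ p.1.2 j'}
      simp only [Set.ofPred_exists, Set.ofPred_and]
      exact MeasurableSet.iUnion fun j => (MeasurableSet.const _).inter <|
        MeasurableSet.iUnion fun j' => (MeasurableSet.const _).inter <|
        (MeasurableSet.const _).inter <| (measurableSet_lt measurable_snd (hb j)).inter
          (measurableSet_le hs (hb j'))
  calc _ = ∫⁻ w, ∑ i, volume {v : ℝ | w.1 i ≤ v ∧
          ∃ j ∈ J i, ∃ j' ∈ J i, j ≠ j' ∧ v < w.2 j ∧ w.1 i ≤ w.2 j'}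
          ∂(marketLaw FS FB mS mB) := (lintegral_sum_volume_eq _ hm).symm
    _ ≤ BTR FS FB mS mB := lintegral_mono fun w => sum_volume_le_ofReal_btrGFT w.1 w.2 J hJ

end

/-! ### Group sizes and conclusion -/

/-- Disjoint groups of `N` elements each. -/
theorem exists_disjoint_groups {m N n : ℕ} (h : m * N ≤ n) :
    ∃ J : Fin m → Finset (Fin n), (∀ i, (J i).card = N) ∧
      Pairwise fun i i' => Disjoint (J i) (J i') := by
  classical
  let e : Fin m × Fin N ↪ Fin n := finProdFinEquiv.toEmbedding.trans (Fin.castLEEmb h)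
  refine ⟨fun i => Finset.univ.image fun x => e (i, x), fun i => ?_, fun i i' hne => ?_⟩
  · rw [Finset.card_image_of_injective _ fun x y hxy => (Prod.ext_iff.1 (e.injective hxy)).2]
    simp
  · refine Finset.disjoint_left.2 fun j hj hj' => hne ?_
    obtain ⟨x, -, hx⟩ := Finset.mem_image.1 hj
    obtain ⟨x', -, hx'⟩ := Finset.mem_image.1 hj'
    exact (Prod.ext_iff.1 (e.injective (hx.trans hx'.symm))).1

theorem exists_group_size {m k n : ℕ} (hm : 0 < m) (hk : 0 < k)
    (hn : (m : ℝ) * ((k : ℝ) + 4 * Real.sqrt (k : ℝ)) ≤ (n : ℝ)) :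
    ∃ r : ℕ, 2 * k ≤ r * (r + 1) ∧ m * (k + r + 1) ≤ n := by
  have hk1 : (1 : ℝ) ≤ k := by exact_mod_cast hk
  have hm0 : (0 : ℝ) < m := by exact_mod_cast hm
  have hsq := Real.sq_sqrt (zero_le_one.trans hk1)
  have hs1 := Real.one_le_sqrt.2 hk1
  have hlt : (n : ℝ) < m * ((n / m : ℕ) + 1) := by exact_mod_cast Nat.lt_mul_div_succ n hm
  have hN : (k : ℝ) + 4 * Real.sqrt k < (n / m : ℕ) + 1 :=
    lt_of_mul_lt_mul_left (hn.trans_lt hlt) hm0.le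
  have hNk : k + 3 < n / m := by
    have : (k : ℝ) + 3 < (n / m : ℕ) := by linarith
    exact_mod_cast this
  -- The group size is the floor of n/m, written k + r + 1. Then r + 2 > 4√k with √k ≥ 1 gives r >
  -- 2√k, so r² > 4k.
  obtain ⟨r, hr⟩ := Nat.exists_eq_add_of_lt (show k < n / m by omega)
  refine ⟨r, ?_, hr ▸ Nat.mul_div_le n m⟩
  rw [hr] at hN hNk
  have hr3 : (3 : ℝ) ≤ r := by exact_mod_cast (show 3 ≤ r by omega)
  push_cast at hN
  have : 2 * (k : ℝ) ≤ r * (r + 1) := by nlinarith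
  exact_mod_cast this

end DoubleAuction

theorem theorem6p1 (FS FB : MeasureTheory.Measure ℝ)
    [MeasureTheory.IsProbabilityMeasure FS] [MeasureTheory.IsProbabilityMeasure FB]
    (hFS : ∀ᵐ x ∂FS, 0 ≤ x) (hFB : ∀ᵐ x ∂FB, 0 ≤ x)
    (hdom : DoubleAuction.StochasticallyDominates FB FS)
    (mS mB n : ℕ) (hn : (mS : ℝ) * ((mB : ℝ) + 4 * Real.sqrt (mB : ℝ)) ≤ (n : ℝ)) :
    DoubleAuction.OPT FS FB mS mB ≤ DoubleAuction.BTR FS FB mS n := by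
  refine (DoubleAuction.OPT_le_sum FS FB).trans ?_
  rcases Nat.eq_zero_or_pos mS with rfl | hm
  · simp
  -- Without buyers n may be 0, leaving no groups to form; the bound on the optimum is then 0.
  rcases Nat.eq_zero_or_pos mB with rfl | hk
  · simp
  obtain ⟨r, hr, hrn⟩ := DoubleAuction.exists_group_size hm hk hn
  obtain ⟨J, hJ, hdisj⟩ := DoubleAuction.exists_disjoint_groups hrn
  refine le_trans (Finset.sum_le_sum fun i _ => lintegral_mono fun v => ?_)
    (DoubleAuction.sum_le_BTR FS FB J hdisj)
  refine (ENNReal.toReal_le_toReal (measure_ne_top _ _) (measure_ne_top _ _)).1 ?_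
  refine (DoubleAuction.marketLaw_trade FS FB i Finset.univ v).trans_le ?_
  rw [Finset.card_univ, Fintype.card_fin]
  exact DoubleAuction.le_marketLaw_reduced FS FB
    (DoubleAuction.real_Iic_le_of_stochasticallyDominates hdom) i (J i) v hr (hJ i)
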